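/- For a compact set $C\subset\mathbb{R}$ with convex hull $I$, let $(G_n)$ be the bounded connected components of $\mathbb{R}\setminus C$, ordered by decreasing length (ties being broken in any way, say from left to right). Each $G_n$ is contained in a connected component $I_n$ of $I\setminus(G_1\cup\dots\cup G_{n-1})$; let $L_n$ and $R_n$ be the left and right closed intervals that make up $I_n\setminus G_n$. The (Newhouse) thickness of $C$ is $$\tau(C)=\inf_n \frac{\min\{|L_n|,|R_n|\}}{|G_n|}\in[0,\infty],$$ where a non-degenerate interval has thickness $+\infty$ and a set with at most one point has thickness $0$. Put $$N(\tau)=\left\lfloor \frac{\log 4}{4e\,(720)^2}\cdot\frac{\tau}{\log\tau}\right\rfloor\quad(e\le\tau<\infty),\qquad N(\infty)=\infty .$$ Let $C\subset\mathbb{R}$ be a compact set with thickness $\tau=\tau(C)\ge e$, and let $A\subset\mathbb{R}$ be a finite set with at most $N(\tau)$ elements. Then: 1. $C$ contains a homothetic copy of $A$: there are $\lambda>0$ and $x\in\mathbb{R}$ with $\lambda A+x\subset C$. 2. There is $\lambda>0$ such that the set $\{x\in\mathbb{R}:\lambda A+x\subset C\}$ has positive Hausdorff dimension. 3. If $\operatorname{diam}(A)<\operatorname{diam}(C)/8$,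 one can take $\lambda=1$: the set $\{x\in\mathbb{R}: A+x\subset C\}$ has positive Hausdorff dimension. -/

import Mathlib

open MeasureTheory
open scoped ENNReal

noncomputable section

/-- The gaps of a closed set `C ⊆ ℝ`: the bounded connected components of `ℝ \ C`, each of them
given as the pair `(a, b)` of endpoints of the open interval `Ioo a b`. -/
def gaps (C : Set ℝ) : Set (ℝ × ℝ) :=
  {g | g.1 < g.2 ∧ g.1 ∈ C ∧ g.2 ∈ C ∧ Disjoint (Set.Ioo g.1 g.2) C}

/-- The order in which the gaps are removed from the convex hull: by decreasing length, and gaps of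
equal length from left to right. -/
def RemovedBefore (h g : ℝ × ℝ) : Prop :=
  g.2 - g.1 < h.2 - h.1 ∨ (h.2 - h.1 = g.2 - g.1 ∧ h.1 < g.1)

/-- What is left of the convex hull of `C` once the gap `g` and all the gaps that come before it
have been removed. -/
def stage (C : Set ℝ) (g : ℝ × ℝ) : Set ℝ :=
  convexHull ℝ C \ ⋃ h ∈ {h ∈ gaps C | h = g ∨ RemovedBefore h g}, Set.Ioo h.1 h.2

/-- The closed interval on the left of the gap `g` at the stage when `g` is removed. -/
def leftPiece (C : Set ℝ) (g : ℝ × ℝ) : Set ℝ := connectedComponentIn (stage C g) g.1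

/-- The closed interval on the right of the gap `g` at the stage when `g` is removed. -/
def rightPiece (C : Set ℝ) (g : ℝ × ℝ) : Set ℝ := connectedComponentIn (stage C g) g.2

open Classical in
/-- Newhouse thickness of a compact set `C ⊆ ℝ`: the infimum over all gaps `G` of
`min (|L|, |R|) / |G|`. It is `∞` for a non-degenerate interval (an infimum over the empty set) and
`0` for a singleton (and for the empty set). -/
def thickness (C : Set ℝ) : ℝ≥0∞ :=
  if C.Subsingleton then 0
  else ⨅ g ∈ gaps C,
    min (volume (leftPiece C g)) (volume (rightPiece C g)) / ENNReal.ofReal (g.2 - g.1)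

open Classical in
/-- `N(τ) = ⌊ log 4 / (4 e 720²) · τ / log τ ⌋`, with `N(∞) = ∞`. -/
def patternBound (τ : ℝ≥0∞) : ℕ∞ :=
  if τ = ⊤ then ⊤
  else ((⌊Real.log 4 / (4 * Real.exp 1 * 720 ^ 2) * (τ.toReal / Real.log τ.toReal)⌋₊ : ℕ) : ℕ∞)

/-- The set of all `x` such that `r A + x ⊆ C`. -/
def copySet (C : Set ℝ) (A : Finset ℝ) (r : ℝ) : Set ℝ :=
  {x | ∀ a ∈ A, r * a + x ∈ C}

end

/-! The point `x` has `A + x ⊆ C` as soon as `A + x` lies in the hull of `C` and `x` avoids, for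
every `a ∈ A`, all gaps of `C` translated by `-a`. Thickness enters only through separation: two
gaps of `C` are at distance at least `τ` times the length of the shorter one
(`intervalsSeparated_gaps`).

Good points are found by a stopping-free tree argument. At scale `ℓ`, only gaps longer than `ℓ / τ`
count, and an interval is kept if these cover at most a quarter of it, summed over `a`
(`LittleCovered`). Cut a kept interval into `T = 2 ^ k` children. For each `a` at most one counted
gap meets it, so these gaps spoil about `T / 4 + 2 |A|` children at most. The remaining children see
only newly counted gaps, with lengths in `(ℓ / (T τ), ℓ / τ]`. By separation the `(j+1)`-st longest
of them has length at most `ℓ / (j τ)`, so they cover at most `(ℓ / τ) (1 + H_T)` for each `a`,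
where `H_T` is the harmonic sum, of order `log T`. With `T` comparable to `τ` and `|A| log τ` at
most a small multiple of `τ`, this spoils few further children, and two separated ones are kept
(`LittleCovered.exists_children`).

Iterating gives a binary tree. Its limit set avoids all translated gaps, since a point inside a gap
would eventually have its whole tree interval swallowed by that gap. The limit set maps onto `[0,
1]` by a Hölder map reading off binary digits, so its dimension is positive
(`dimH_pos_of_binary_tree`). -/

/-! ### Counting and measure bounds for separated intervals -/

/-- Points of an interval that are pairwise at distance at least `d` are few. -/
theorem card_sub_one_mul_le_of_pairwise_dist {P : Finset ℝ} {u v d : ℝ} (hd : 0 ≤ d) (huv : u ≤ v)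
    (hP : ∀ x ∈ P, x ∈ Set.Icc u v) (hsep : ∀ x ∈ P, ∀ y ∈ P, x ≠ y → d ≤ |x - y|) :
    ((P.card : ℝ) - 1) * d ≤ v - u := by
  induction P using Finset.induction_on_max generalizing v with
  | empty => simp; linarith
  | insert a s hs ih =>
    have ha : a ∉ s := fun h => lt_irrefl _ (hs a h)
    rw [Finset.card_insert_of_notMem ha]
    have hav := hP a (Finset.mem_insert_self a s)
    rcases s.eq_empty_or_nonempty with rfl | ⟨b, hb⟩
    · simp; linarith
    · have key : ∀ x ∈ s, x ≤ a - d := fun x hx => by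
        have h := hsep a (Finset.mem_insert_self a s) x (Finset.mem_insert_of_mem hx)
          (hs x hx).ne'
        rw [abs_of_pos (sub_pos.2 (hs x hx))] at h
        linarith
      have hub : u ≤ b := (hP b (Finset.mem_insert_of_mem hb)).1
      have := ih (v := a - d) (hub.trans (key b hb))
        (fun x hx => ⟨(hP x (Finset.mem_insert_of_mem hx)).1, key x hx⟩)
        (fun x hx y hy => hsep x (Finset.mem_insert_of_mem hx) y (Finset.mem_insert_of_mem hy))
      push_cast
      linarith [hav.2]

/-- A family of open intervals, given by their endpoints, any two of which are at distance at least
`τ` times the length of the shorter one. -/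
def IntervalsSeparated (τ : ℝ) (Γ : Set (ℝ × ℝ)) : Prop :=
  ∀ g ∈ Γ, ∀ h ∈ Γ, g ≠ h → ∀ x ∈ Set.Ioo g.1 g.2, ∀ y ∈ Set.Ioo h.1 h.2,
    τ * min (g.2 - g.1) (h.2 - h.1) ≤ |x - y|

/-- The union of the intervals of `Γ` that are longer than `s`. -/
def longUnion (Γ : Set (ℝ × ℝ)) (s : ℝ) : Set ℝ :=
  ⋃ g ∈ {g ∈ Γ | s < g.2 - g.1}, Set.Ioo g.1 g.2

theorem mem_longUnion {Γ : Set (ℝ × ℝ)} {s x : ℝ} :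
    x ∈ longUnion Γ s ↔ ∃ g ∈ Γ, s < g.2 - g.1 ∧ x ∈ Set.Ioo g.1 g.2 := by
  simp only [longUnion, Set.mem_iUnion, Set.mem_ofPred_eq, exists_prop, and_assoc]

theorem isOpen_longUnion (Γ : Set (ℝ × ℝ)) (s : ℝ) : IsOpen (longUnion Γ s) :=
  isOpen_biUnion fun _ _ => isOpen_Ioo

/-- An interval of length `ℓ` meets at most one of the intervals longer than `ℓ / τ`. -/
theorem IntervalsSeparated.eq_of_long {τ u ℓ x y : ℝ} {Γ : Set (ℝ × ℝ)}
    (hΓ : IntervalsSeparated τ Γ) (hτ : 0 < τ) {g h : ℝ × ℝ} (hg : g ∈ Γ) (hh : h ∈ Γ)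
    (hlg : ℓ / τ < g.2 - g.1) (hlh : ℓ / τ < h.2 - h.1) (hx : x ∈ Set.Ico u (u + ℓ))
    (hy : y ∈ Set.Ico u (u + ℓ)) (hxg : x ∈ Set.Ioo g.1 g.2) (hyh : y ∈ Set.Ioo h.1 h.2) :
    g = h := by
  by_contra e
  have h1 := hΓ g hg h hh e x hxg y hyh
  have h2 : τ * (ℓ / τ) < τ * min (g.2 - g.1) (h.2 - h.1) :=
    mul_lt_mul_of_pos_left (lt_min hlg hlh) hτ
  rw [mul_div_cancel₀ _ hτ.ne'] at h2
  have : |x - y| < ℓ := abs_lt.2 ⟨by linarith [hy.2, hx.1], by linarith [hy.1, hx.2]⟩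
  linarith

/-- One point of the window chosen in each interval gives a `τ * s`-separated set, to which the
point count applies. -/
theorem IntervalsSeparated.card_sub_one_mul_le {τ u ℓ s : ℝ} {Γ : Set (ℝ × ℝ)}
    (hΓ : IntervalsSeparated τ Γ) (hτ : 0 < τ) (hs : 0 < s) (hℓ : 0 ≤ ℓ) {F : Finset (ℝ × ℝ)}
    (hF : ↑F ⊆ Γ) (hmeet : ∀ g ∈ F, (Set.Ioo g.1 g.2 ∩ Set.Ico u (u + ℓ)).Nonempty)
    (hlong : ∀ g ∈ F, s ≤ g.2 - g.1) : ((F.card : ℝ) - 1) * (τ * s) ≤ ℓ := by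
  classical
  choose! p hp using hmeet
  have hsep : ∀ g ∈ F, ∀ h ∈ F, g ≠ h → τ * s ≤ |p g - p h| := fun g hg h hh hne =>
    (mul_le_mul_of_nonneg_left (le_min (hlong g hg) (hlong h hh)) hτ.le).trans
      (hΓ g (hF hg) h (hF hh) hne _ (hp g hg).1 _ (hp h hh).1)
  have hinj : Set.InjOn p F := fun g hg h hh heq => by
    by_contra hne
    have h1 := hsep g hg h hh hne
    rw [heq, sub_self, abs_zero] at h1
    exact absurd h1 (not_le.2 (mul_pos hτ hs))
  have := card_sub_one_mul_le_of_pairwise_dist (P := F.image p) (u := u) (v := u + ℓ)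
    (mul_pos hτ hs).le (by linarith)
    (by
      simp only [Finset.mem_image]
      rintro x ⟨g, hg, rfl⟩
      exact ⟨(hp g hg).2.1, (hp g hg).2.2.le⟩)
    (by
      simp only [Finset.mem_image]
      rintro x ⟨g, hg, rfl⟩ y ⟨h, hh, rfl⟩ hne
      exact hsep g hg h hh fun e => hne (by rw [e]))
  rw [Finset.card_image_of_injOn hinj] at this
  linarith

/-- The total length of the intervals of a separated family that meet a given interval. -/
theorem IntervalsSeparated.sum_length_le {τ u ℓ m : ℝ} {Γ : Set (ℝ × ℝ)}
    (hΓ : IntervalsSeparated τ Γ) (hτ : 0 < τ) (hℓ : 0 ≤ ℓ) (n : ℕ) {F : Finset (ℝ × ℝ)}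
    (hF : ↑F ⊆ Γ) (hmeet : ∀ g ∈ F, (Set.Ioo g.1 g.2 ∩ Set.Ico u (u + ℓ)).Nonempty)
    (hshort : ∀ g ∈ F, g.2 - g.1 ≤ m) (hcard : F.card = n + 1) :
    ∑ g ∈ F, (g.2 - g.1) ≤ m + ℓ / τ * (harmonic n : ℝ) := by
  classical
  induction n generalizing F with
  | zero =>
    obtain ⟨g, rfl⟩ := Finset.card_eq_one.1 hcard
    simpa using hshort g (by simp)
  | succ n ih =>
    obtain ⟨g, hg, hmin⟩ := F.exists_min_image (fun g => g.2 - g.1)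
      (Finset.card_pos.1 (by omega))
    have hpos : 0 < g.2 - g.1 := by
      obtain ⟨x, hx, -⟩ := hmeet g hg
      linarith [hx.1, hx.2]
    -- The count with threshold the shortest of the `n + 2` intervals bounds that length by `ℓ / (τ
    -- (n + 1))`, the new term of the harmonic sum.
    have h1 := hΓ.card_sub_one_mul_le hτ hpos hℓ hF hmeet hmin
    have h2 := ih (F := F.erase g) (fun h hh => hF (Finset.mem_of_mem_erase hh))
      (fun h hh => hmeet h (Finset.mem_of_mem_erase hh))
      (fun h hh => hshort h (Finset.mem_of_mem_erase hh))
      (by rw [Finset.card_erase_of_mem hg]; omega)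
    rw [← Finset.sum_erase_add _ _ hg, harmonic_succ]
    rw [hcard] at h1
    push_cast at h1 ⊢
    have h3 : g.2 - g.1 ≤ ℓ / τ * ((n : ℝ) + 1)⁻¹ := by
      rw [div_mul_eq_mul_div, le_div_iff₀ hτ, ← div_eq_mul_inv, le_div_iff₀ (by positivity)]
      linarith
    rw [mul_add]
    linarith

/-- The part of an interval of length `ℓ` covered by the intervals of medium length. -/
theorem IntervalsSeparated.volume_medium_le {τ u ℓ : ℝ} {T : ℕ} {Γ : Set (ℝ × ℝ)}
    (hΓ : IntervalsSeparated τ Γ) (hτ : 0 < τ) (hℓ : 0 < ℓ) (hT : 0 < T) :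
    volume.real (Set.Ico u (u + ℓ) ∩ (longUnion Γ (ℓ / T / τ) \ longUnion Γ (ℓ / τ))) ≤
      ℓ / τ * (1 + (harmonic T : ℝ)) := by
  classical
  have hT' : (0 : ℝ) < T := Nat.cast_pos.2 hT
  have hs : 0 < ℓ / T / τ := by positivity
  set G : Set (ℝ × ℝ) := {g | g ∈ Γ ∧ ℓ / T / τ < g.2 - g.1 ∧ g.2 - g.1 ≤ ℓ / τ ∧
    (Set.Ioo g.1 g.2 ∩ Set.Ico u (u + ℓ)).Nonempty} with hG
  have hcard : ∀ F : Finset (ℝ × ℝ), ↑F ⊆ G → F.card ≤ T + 1 := fun F hF => by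
    have h := hΓ.card_sub_one_mul_le hτ hs hℓ.le (fun g hg => (hF hg).1)
      (fun g hg => (hF hg).2.2.2) (fun g hg => (hF hg).2.1.le)
    have e : τ * (ℓ / T / τ) = ℓ / T := by field_simp
    rw [e, mul_div_assoc', div_le_iff₀ hT', mul_comm] at h
    have h' := le_of_mul_le_mul_left h hℓ
    have : (F.card : ℝ) ≤ (T + 1 : ℕ) := by push_cast; linarith
    exact_mod_cast this
  have hfin : G.Finite := by
    by_contra hinf
    obtain ⟨F, hF, hc⟩ := Set.Infinite.exists_subset_card_eq hinf (T + 2)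
    have := hcard F hF
    omega
  set F := hfin.toFinset with hFdef
  have hFG : ∀ g, g ∈ F ↔ g ∈ G := fun g => hfin.mem_toFinset
  have hFG' : ↑F ⊆ G := fun g hg => (hFG g).1 hg
  have hsub : Set.Ico u (u + ℓ) ∩ (longUnion Γ (ℓ / T / τ) \ longUnion Γ (ℓ / τ)) ⊆
      ⋃ g ∈ F, Set.Ioo g.1 g.2 := by
    rintro x ⟨hxI, hx, hx'⟩
    obtain ⟨g, hg, hlen, hxg⟩ := mem_longUnion.1 hx
    refine Set.mem_biUnion (x := g) ((hFG g).2 ⟨hg, hlen, ?_, x, hxg, hxI⟩) hxg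
    by_contra hlt
    exact hx' (mem_longUnion.2 ⟨g, hg, not_le.1 hlt, hxg⟩)
  have hle : volume.real (⋃ g ∈ F, Set.Ioo g.1 g.2) ≤ ∑ g ∈ F, (g.2 - g.1) := by
    refine (measureReal_biUnion_finset_le _ _).trans (Finset.sum_le_sum fun g hg => ?_)
    have := (hFG' hg).2.1
    rw [Real.volume_real_Ioo_of_le (by linarith)]
  have hfinite : volume (⋃ g ∈ F, Set.Ioo g.1 g.2) ≠ ⊤ :=
    (measure_biUnion_lt_top F.finite_toSet fun g _ => measure_Ioo_lt_top).ne
  refine (measureReal_mono hsub hfinite).trans (hle.trans ?_)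
  have hh0 : (0 : ℝ) ≤ (harmonic T : ℝ) := by
    unfold harmonic; push_cast; positivity
  rcases F.eq_empty_or_nonempty with h0 | hne
  · rw [h0, Finset.sum_empty]; positivity
  · obtain ⟨n, hn⟩ : ∃ n, F.card = n + 1 := ⟨F.card - 1, by have := hne.card_pos; omega⟩
    have h := hΓ.sum_length_le (u := u) hτ hℓ.le n (fun g hg => (hFG' hg).1)
      (fun g hg => (hFG' hg).2.2.2) (fun g hg => (hFG' hg).2.2.1) hn
    have hnT : n ≤ T := by have := hcard F hFG'; omega
    have hmono : (harmonic n : ℝ) ≤ (harmonic T : ℝ) := by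
      unfold harmonic
      push_cast
      exact Finset.sum_le_sum_of_subset_of_nonneg (Finset.range_subset_range.2 hnT)
        fun i _ _ => by positivity
    refine h.trans ?_
    rw [mul_add, mul_one]
    gcongr

/-! ### Subdividing an interval and selecting good children -/

theorem child_subset {u ℓ : ℝ} {T i : ℕ} (hℓ : 0 < ℓ) (hi : i < T) :
    Set.Ico (u + i * (ℓ / T)) (u + i * (ℓ / T) + ℓ / T) ⊆ Set.Ico u (u + ℓ) := by
  have hT' : (0 : ℝ) < T := Nat.cast_pos.2 (by omega)
  have h1 : 0 ≤ (i : ℝ) * (ℓ / T) := by positivity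
  have h2 : ((i : ℝ) + 1) * (ℓ / T) ≤ T * (ℓ / T) := by
    gcongr
    exact_mod_cast hi
  have h3 : T * (ℓ / T) = ℓ := by field_simp
  exact Set.Ico_subset_Ico (by linarith) (by linarith)

theorem pairwiseDisjoint_child {u d : ℝ} (hd : 0 ≤ d) (S : Set ℕ) :
    S.PairwiseDisjoint fun i : ℕ => Set.Ico (u + i * d) (u + i * d + d) := by
  have key : ∀ i j : ℕ, i < j →
      Disjoint (Set.Ico (u + i * d) (u + i * d + d)) (Set.Ico (u + j * d) (u + j * d + d)) := by
    intro i j hij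
    rw [Set.disjoint_left]
    intro x hx hx'
    have : ((i : ℝ) + 1) * d ≤ j * d := by
      gcongr
      exact_mod_cast hij
    linarith [hx.2, hx'.1]
  intro i _ j _ hij
  rcases lt_or_gt_of_ne hij with h | h
  · exact key i j h
  · exact (key j i h).symm

theorem sum_volume_child_le {u ℓ : ℝ} {T : ℕ} (hℓ : 0 < ℓ) {S : Finset ℕ}
    (hS : ∀ i ∈ S, i < T) {E : Set ℝ} (hE : MeasurableSet E) :
    ∑ i ∈ S, volume.real (Set.Ico (u + i * (ℓ / T)) (u + i * (ℓ / T) + ℓ / T) ∩ E) ≤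
      volume.real (Set.Ico u (u + ℓ) ∩ E) := by
  rw [← measureReal_biUnion_finset ((pairwiseDisjoint_child (by positivity) _).mono_on
      fun i _ => Set.inter_subset_left) (fun i _ => measurableSet_Ico.inter hE)
    (fun i _ => ((measure_mono Set.inter_subset_left).trans_lt measure_Ico_lt_top).ne)]
  refine measureReal_mono (Set.iUnion₂_subset fun i hi =>
    Set.inter_subset_inter_left _ (child_subset hℓ (hS i hi))) ?_
  exact ((measure_mono Set.inter_subset_left).trans_lt measure_Ico_lt_top).ne

/-- The number of children of an interval that meet one of the long intervals of the family. -/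
theorem IntervalsSeparated.card_child_meeting_le {τ u ℓ : ℝ} {T : ℕ} {Γ : Set (ℝ × ℝ)}
    (hΓ : IntervalsSeparated τ Γ) (hτ : 0 < τ) (hℓ : 0 < ℓ) {S : Finset ℕ}
    (hS : ∀ i ∈ S, i < T)
    (hmeet : ∀ i ∈ S, (Set.Ico (u + i * (ℓ / T)) (u + i * (ℓ / T) + ℓ / T) ∩
      longUnion Γ (ℓ / τ)).Nonempty) :
    S.card * (ℓ / T) ≤ volume.real (Set.Ico u (u + ℓ) ∩ longUnion Γ (ℓ / τ)) + 2 * (ℓ / T) := by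
  have hd : 0 ≤ ℓ / T := by positivity
  set d := ℓ / T with hddef
  rcases S.eq_empty_or_nonempty with rfl | ⟨i₀, hi₀⟩
  · simp; positivity
  obtain ⟨x₀, hx₀, hx₀'⟩ := hmeet i₀ hi₀
  obtain ⟨g, hg, hlen, hxg⟩ := mem_longUnion.1 hx₀'
  have hglt : g.1 < g.2 := hxg.1.trans hxg.2
  have huniq : ∀ i ∈ S, ∃ x, x ∈ Set.Ico (u + i * d) (u + i * d + d) ∧ x ∈ Set.Ioo g.1 g.2 := by
    intro i hi
    obtain ⟨x, hx, hx'⟩ := hmeet i hi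
    obtain ⟨h, hh, hlen', hxh⟩ := mem_longUnion.1 hx'
    have e := hΓ.eq_of_long hτ hg hh hlen hlen' (child_subset hℓ (hS i₀ hi₀) hx₀)
      (child_subset hℓ (hS i hi) hx) hxg hxh
    exact ⟨x, hx, e ▸ hxh⟩
  -- All these children meet the same long interval `g`, so they stick out of it by at most `d` on
  -- each side; this is the `2 * (ℓ / T)`.
  have hsub : ⋃ i ∈ S, Set.Ico (u + i * d) (u + i * d + d) ⊆
      ((Set.Ico u (u + ℓ) ∩ longUnion Γ (ℓ / τ)) ∪ Set.Icc (g.1 - d) g.1) ∪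
        Set.Icc g.2 (g.2 + d) := by
    refine Set.iUnion₂_subset fun i hi y hy => ?_
    obtain ⟨x, hx, hxg'⟩ := huniq i hi
    rcases le_or_gt y g.1 with h | h
    · exact Or.inl (Or.inr ⟨by linarith [hx.2, hy.1, hxg'.1], h⟩)
    rcases le_or_gt g.2 y with h' | h'
    · exact Or.inr ⟨h', by linarith [hx.1, hy.2, hxg'.2]⟩
    · exact Or.inl (Or.inl ⟨child_subset hℓ (hS i hi) hy, mem_longUnion.2 ⟨g, hg, hlen, h, h'⟩⟩)
  have hcount : volume.real (⋃ i ∈ S, Set.Ico (u + i * d) (u + i * d + d)) = S.card * d := by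
    rw [measureReal_biUnion_finset (pairwiseDisjoint_child hd _) (fun _ _ => measurableSet_Ico)
      (fun _ _ => measure_Ico_lt_top.ne)]
    rw [Finset.sum_congr rfl fun i _ => Real.volume_real_Ico_of_le (by linarith)]
    simp
  rw [← hcount]
  have hfin : volume (Set.Ico u (u + ℓ) ∩ longUnion Γ (ℓ / τ)) ≠ ⊤ :=
    ((measure_mono Set.inter_subset_left).trans_lt measure_Ico_lt_top).ne
  refine (measureReal_mono hsub ?_).trans ?_
  · exact measure_union_ne_top (measure_union_ne_top hfin measure_Icc_lt_top.ne)
      measure_Icc_lt_top.ne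
  · refine (measureReal_union_le _ _).trans ?_
    have h1 := measureReal_union_le (μ := volume) (Set.Ico u (u + ℓ) ∩ longUnion Γ (ℓ / τ))
      (Set.Icc (g.1 - d) g.1)
    rw [Real.volume_real_Icc_of_le (by linarith)] at h1 ⊢
    linarith

/-- The intervals of the families `Γ a` that are not short compared with `ℓ` cover at most a
quarter of `[u, u + ℓ)`. -/
def LittleCovered {ι : Type*} (Γ : ι → Set (ℝ × ℝ)) (A : Finset ι) (τ ℓ u : ℝ) : Prop :=
  ∑ a ∈ A, volume.real (Set.Ico u (u + ℓ) ∩ longUnion (Γ a) (ℓ / τ)) ≤ ℓ / 4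

/-- A child fails either because an interval already counted at scale `ℓ` meets it (the set `O`) or
because the medium intervals alone cover more than a quarter of it (the set `B`). Both sets are
small, the second by summing measures over disjoint children. -/
theorem LittleCovered.exists_children {ι : Type*} {Γ : ι → Set (ℝ × ℝ)} {A : Finset ι} {τ ℓ u : ℝ}
    {T : ℕ} (hΓ : ∀ a ∈ A, IntervalsSeparated τ (Γ a)) (hτ : 0 < τ) (hℓ : 0 < ℓ) (hT : 6 ≤ T)
    (hcard : 16 * A.card ≤ T) (hsum : (A.card : ℝ) * (1 + (harmonic T : ℝ)) ≤ τ / 64)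
    (h : LittleCovered Γ A τ ℓ u) :
    ∃ i j : ℕ, i + 2 ≤ j ∧ j < T ∧ LittleCovered Γ A τ (ℓ / T) (u + i * (ℓ / T)) ∧
      LittleCovered Γ A τ (ℓ / T) (u + j * (ℓ / T)) := by
  classical
  have hT' : (0 : ℝ) < T := Nat.cast_pos.2 (by omega)
  set d := ℓ / T with hd
  have hdpos : 0 < d := by positivity
  have hdT : T * d = ℓ := by rw [hd]; field_simp
  let K : ℕ → Set ℝ := fun i => Set.Ico (u + i * d) (u + i * d + d)
  let Q : ι → Finset ℕ := fun a =>
    {i ∈ Finset.range T | (K i ∩ longUnion (Γ a) (ℓ / τ)).Nonempty}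
  let M : ι → Set ℝ := fun a => longUnion (Γ a) (d / τ) \ longUnion (Γ a) (ℓ / τ)
  have hM : ∀ a, MeasurableSet (M a) := fun a =>
    (isOpen_longUnion _ _).measurableSet.diff (isOpen_longUnion _ _).measurableSet
  let O := A.biUnion Q
  let B : Finset ℕ := {i ∈ Finset.range T \ O | ¬ LittleCovered Γ A τ d (u + i * d)}
  let G : Finset ℕ := {i ∈ Finset.range T \ O | LittleCovered Γ A τ d (u + i * d)}
  have hO : (O.card : ℝ) * d ≤ ℓ / 4 + A.card * (2 * d) := by
    calc (O.card : ℝ) * d ≤ (∑ a ∈ A, ((Q a).card : ℝ)) * d := by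
          gcongr
          exact_mod_cast Finset.card_biUnion_le
      _ = ∑ a ∈ A, (Q a).card * d := Finset.sum_mul ..
      _ ≤ ∑ a ∈ A, (volume.real (Set.Ico u (u + ℓ) ∩ longUnion (Γ a) (ℓ / τ)) + 2 * d) :=
          Finset.sum_le_sum fun a ha => (hΓ a ha).card_child_meeting_le hτ hℓ
            (fun i hi => Finset.mem_range.1 (Finset.mem_filter.1 hi).1)
            (fun i hi => (Finset.mem_filter.1 hi).2)
      _ ≤ ℓ / 4 + A.card * (2 * d) := by
          rw [Finset.sum_add_distrib, Finset.sum_const, nsmul_eq_mul]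
          have := h
          unfold LittleCovered at this
          linarith
  -- A child outside `O` misses every interval longer than `ℓ / τ`, so only medium ones can cover
  -- it.
  have hBsum : ∀ i ∈ B, d / 4 ≤ ∑ a ∈ A, volume.real (K i ∩ M a) := by
    intro i hi
    obtain ⟨hi1, hi2⟩ := Finset.mem_filter.1 hi
    obtain ⟨hi3, hi4⟩ := Finset.mem_sdiff.1 hi1
    refine (not_le.1 hi2).le.trans (Finset.sum_le_sum fun a ha => ?_)
    refine measureReal_mono ?_
      ((measure_mono Set.inter_subset_left).trans_lt measure_Ico_lt_top).ne
    rintro x ⟨hx, hx'⟩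
    refine ⟨hx, hx', fun hx'' => hi4 ?_⟩
    exact Finset.mem_biUnion.2 ⟨a, ha, Finset.mem_filter.2 ⟨hi3, x, hx, hx''⟩⟩
  have hB : (B.card : ℝ) * (d / 4) ≤ ℓ / 64 := by
    calc (B.card : ℝ) * (d / 4) = ∑ i ∈ B, d / 4 := by simp
      _ ≤ ∑ i ∈ B, ∑ a ∈ A, volume.real (K i ∩ M a) := Finset.sum_le_sum hBsum
      _ = ∑ a ∈ A, ∑ i ∈ B, volume.real (K i ∩ M a) := Finset.sum_comm
      _ ≤ ∑ a ∈ A, volume.real (Set.Ico u (u + ℓ) ∩ M a) :=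
          Finset.sum_le_sum fun a _ => sum_volume_child_le hℓ (fun i hi =>
            Finset.mem_range.1 (Finset.mem_sdiff.1 (Finset.mem_filter.1 hi).1).1) (hM a)
      _ ≤ ∑ a ∈ A, ℓ / τ * (1 + (harmonic T : ℝ)) :=
          Finset.sum_le_sum fun a ha => (hΓ a ha).volume_medium_le hτ hℓ (by omega)
      _ = ℓ / τ * (A.card * (1 + (harmonic T : ℝ))) := by simp; ring
      _ ≤ ℓ / τ * (τ / 64) := by gcongr
      _ = ℓ / 64 := by field_simp
  have hcount : T ≤ O.card + (G.card + B.card) := by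
    have h1 : G.card + B.card = (Finset.range T \ O).card :=
      Finset.card_filter_add_card_filter_not _
    have h2 := Finset.le_card_sdiff O (Finset.range T)
    rw [Finset.card_range] at h2
    omega
  -- At most `T / 4 + T / 8 + T / 16` children fail, and `9 T / 16 > 2` since `T ≥ 6`. Three good
  -- children force two whose indices differ by at least 2, hence a full child between them.
  have hG : 3 ≤ G.card := by
    have h1 : (O.card : ℝ) ≤ T / 4 + 2 * A.card := by
      refine le_of_mul_le_mul_right ?_ hdpos
      linarith
    have h2 : (B.card : ℝ) ≤ T / 16 := by
      refine le_of_mul_le_mul_right ?_ hdpos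
      linarith
    have h3 : (T : ℝ) ≤ O.card + (G.card + B.card) := by exact_mod_cast hcount
    have h4 : (16 : ℝ) * A.card ≤ T := by exact_mod_cast hcard
    have h5 : (6 : ℝ) ≤ T := by exact_mod_cast hT
    have h6 : (2 : ℝ) < G.card := by linarith
    exact_mod_cast h6
  have hne : G.Nonempty := Finset.card_pos.1 (by omega)
  have hmin := Finset.mem_filter.1 (G.min'_mem hne)
  have hmax := Finset.mem_filter.1 (G.max'_mem hne)
  refine ⟨G.min' hne, G.max' hne, ?_, Finset.mem_range.1 (Finset.mem_sdiff.1 hmax.1).1,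
    hmin.2, hmax.2⟩
  have hsub : G ⊆ Finset.Icc (G.min' hne) (G.max' hne) := fun i hi =>
    Finset.mem_Icc.2 ⟨G.min'_le i hi, G.le_max' i hi⟩
  have := Finset.card_le_card hsub
  rw [Nat.card_Icc] at this
  omega

/-! ### Dimension of the limit set of a binary tree -/

/-- A binary tree of intervals, in which each interval of length `ℓ` contains two separated
intervals of length `ℓ / 2 ^ k`, has at least `1 / k`-dimensional limit set. -/
theorem dimH_pos_of_binary_tree {k : ℕ} (hk : 0 < k) {ℓ u₀ : ℝ} (hℓ : 0 < ℓ)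
    (P : ℝ → ℝ → Prop) (h₀ : P ℓ u₀)
    (hstep : ∀ d u, 0 < d → P d u → ∃ v w, u ≤ v ∧ v + 2 * (d / 2 ^ k) ≤ w ∧
      w + d / 2 ^ k ≤ u + d ∧ P (d / 2 ^ k) v ∧ P (d / 2 ^ k) w) :
    0 < dimH {x : ℝ | ∃ u : ℕ → ℝ, u 0 = u₀ ∧ ∀ n, P (ℓ / (2 ^ k) ^ n) (u n) ∧
      x ∈ Set.Icc (u n) (u n + ℓ / (2 ^ k) ^ n)} := by
  set K := {x : ℝ | ∃ u : ℕ → ℝ, u 0 = u₀ ∧ ∀ n, P (ℓ / (2 ^ k) ^ n) (u n) ∧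
      x ∈ Set.Icc (u n) (u n + ℓ / (2 ^ k) ^ n)} with hK
  have hsucc : ∀ n, ℓ / (2 ^ k) ^ n / 2 ^ k = ℓ / ((2 : ℝ) ^ k) ^ (n + 1) := fun n => by
    rw [div_div, ← pow_succ]
  have hlen : ∀ n, 0 < ℓ / ((2 : ℝ) ^ k) ^ n := fun n => by positivity
  choose! v w huv hvw hwu hPv hPw using hstep
  let next : ℕ → ℝ → Fin 2 → ℝ := fun n u b =>
    if b = 0 then v (ℓ / (2 ^ k) ^ n) u else w (ℓ / (2 ^ k) ^ n) u
  let s : (ℕ → Fin 2) → ℕ → ℝ := fun b n => Nat.rec u₀ (fun m u => next m u (b m)) n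
  have s_succ : ∀ b n, s b (n + 1) = next n (s b n) (b n) := fun b n => rfl
  have sP : ∀ b n, P (ℓ / (2 ^ k) ^ n) (s b n) := by
    intro b n
    induction n with
    | zero => simpa [s] using h₀
    | succ n ih =>
      rw [s_succ, ← hsucc]
      simp only [next]
      split_ifs
      · exact hPv _ _ (hlen n) ih
      · exact hPw _ _ (hlen n) ih
  have hpart : ∀ b n, s b n ≤ s b (n + 1) ∧
      s b (n + 1) + ℓ / (2 ^ k) ^ (n + 1) ≤ s b n + ℓ / (2 ^ k) ^ n := by
    intro b n
    have h1 := huv _ _ (hlen n) (sP b n)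
    have h2 := hvw _ _ (hlen n) (sP b n)
    have h3 := hwu _ _ (hlen n) (sP b n)
    have h4 := hlen (n + 1)
    rw [s_succ]
    rw [hsucc] at h2 h3
    simp only [next]
    split_ifs
    · exact ⟨h1, by linarith⟩
    · exact ⟨by linarith, by linarith⟩
  have hmono : ∀ b, Monotone (s b) := fun b => monotone_nat_of_le_succ fun n => (hpart b n).1
  have hanti : ∀ b, Antitone fun n => s b n + ℓ / ((2 : ℝ) ^ k) ^ n := fun b =>
    antitone_nat_of_succ_le fun n => (hpart b n).2
  let x : (ℕ → Fin 2) → ℝ := fun b => ⨆ n, s b n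
  have hle : ∀ b m n, s b m ≤ s b n + ℓ / ((2 : ℝ) ^ k) ^ n := fun b m n =>
    (hmono b (le_max_left m n)).trans
      ((le_add_of_nonneg_right (hlen _).le).trans (hanti b (le_max_right m n)))
  have hx : ∀ b n, x b ∈ Set.Icc (s b n) (s b n + ℓ / ((2 : ℝ) ^ k) ^ n) := fun b n =>
    ⟨le_ciSup (f := s b) ⟨s b 0 + ℓ / ((2 : ℝ) ^ k) ^ 0, by rintro _ ⟨m, rfl⟩; exact hle b m 0⟩ n,
      ciSup_le fun m => hle b m n⟩
  have hxK : ∀ b, x b ∈ K := fun b => ⟨s b, rfl, fun n => ⟨sP b n, hx b n⟩⟩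
  have hagree : ∀ b c n, (∀ i < n, b i = c i) → s b n = s c n := by
    intro b c n
    induction n with
    | zero => intro _; rfl
    | succ n ih =>
      intro h
      rw [s_succ, s_succ, ih fun i hi => h i (by omega), h n (by omega)]
  have hsep0 : ∀ b c n, (∀ i < n, b i = c i) → b n = 0 → c n ≠ 0 →
      ℓ / ((2 : ℝ) ^ k) ^ (n + 1) ≤ x c - x b := by
    intro b c n h hb hc
    have h1 := (hx b (n + 1)).2
    have h2 := (hx c (n + 1)).1
    have h3 := hvw _ _ (hlen n) (sP b n)
    rw [s_succ] at h1 h2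
    simp only [next, hb, if_true] at h1
    simp only [next, hc, if_false, ← hagree b c n h] at h2
    rw [hsucc] at h3
    linarith
  have hsep : ∀ b c n, (∀ i < n, b i = c i) → b n ≠ c n →
      ℓ / ((2 : ℝ) ^ k) ^ (n + 1) ≤ |x b - x c| := by
    intro b c n h hne
    by_cases hb : b n = 0
    · rw [abs_sub_comm]
      exact (hsep0 b c n h hb fun hc => hne (hb.trans hc.symm)).trans (le_abs_self _)
    · have hc : c n = 0 := by omega
      exact (hsep0 c b n (fun i hi => (h i hi).symm) hc hb).trans (le_abs_self _)
  have hfirst : ∀ b c : ℕ → Fin 2, b ≠ c → ∃ n, (∀ i < n, b i = c i) ∧ b n ≠ c n := by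
    intro b c hne
    obtain ⟨m, hm⟩ := Function.ne_iff.1 hne
    classical
    have hex : ∃ n, b n ≠ c n := ⟨m, hm⟩
    exact ⟨Nat.find hex, fun i hi => not_not.1 (Nat.find_min hex hi), Nat.find_spec hex⟩
  have hinj : Function.Injective x := by
    intro b c h
    by_contra hne
    obtain ⟨n, h1, h2⟩ := hfirst b c hne
    have := hsep b c n h1 h2
    rw [h, sub_self, abs_zero] at this
    exact absurd this (not_le.2 (hlen _))
  -- `f` sends the limit point with address `b` to the number with binary digits `b`.
  let f : ℝ → ℝ := fun y => Real.ofDigits (Function.invFun x y)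
  have hf : ∀ b, f (x b) = Real.ofDigits b := fun b => by
    simp only [f, Function.leftInverse_invFun hinj b]
  have hkR : (0 : ℝ) < k := Nat.cast_pos.2 hk
  -- If two addresses first differ at `n`, the images are within `2⁻ⁿ` while the points are at least
  -- `ℓ / 2 ^ (k (n + 1))` apart; raising the latter to the power `1 / k` gives this constant and
  -- exponent.
  have hholder : HolderOnWith (Real.toNNReal (2 * (ℓ ^ (k : ℝ)⁻¹)⁻¹)) (Real.toNNReal (k : ℝ)⁻¹) f
      (Set.range x) := by
    rw [HolderOnWith]
    rintro _ ⟨b, rfl⟩ _ ⟨c, rfl⟩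
    rw [hf, hf]
    by_cases hbc : b = c
    · rw [hbc, edist_self]; exact zero_le
    obtain ⟨n, h1, h2⟩ := hfirst b c hbc
    have h3 := hsep b c n h1 h2
    have h4 := Real.abs_ofDigits_sub_ofDigits_le h1
    have h5 : (ℓ / ((2 : ℝ) ^ k) ^ (n + 1)) ^ (k : ℝ)⁻¹ ≤ |x b - x c| ^ (k : ℝ)⁻¹ :=
      Real.rpow_le_rpow (hlen _).le h3 (by positivity)
    have h6 : (ℓ / ((2 : ℝ) ^ k) ^ (n + 1)) ^ (k : ℝ)⁻¹ = ℓ ^ (k : ℝ)⁻¹ * (2 ^ (n + 1))⁻¹ := by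
      rw [Real.div_rpow hℓ.le (by positivity), ← pow_mul, mul_comm k, pow_mul,
        Real.pow_rpow_inv_natCast (by positivity) hk.ne', div_eq_mul_inv]
    have hpos : 0 < ℓ ^ (k : ℝ)⁻¹ := Real.rpow_pos_of_pos hℓ _
    have h7 : |Real.ofDigits b - Real.ofDigits c| ≤
        2 * (ℓ ^ (k : ℝ)⁻¹)⁻¹ * |x b - x c| ^ (k : ℝ)⁻¹ := by
      calc |Real.ofDigits b - Real.ofDigits c| ≤ (2 ^ n)⁻¹ := by exact_mod_cast h4
        _ = 2 * (ℓ ^ (k : ℝ)⁻¹)⁻¹ * (ℓ ^ (k : ℝ)⁻¹ * (2 ^ (n + 1))⁻¹) := by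
          rw [pow_succ]; field_simp
        _ ≤ _ := by rw [← h6]; gcongr
    rw [edist_dist, edist_dist, Real.dist_eq, Real.dist_eq,
      Real.coe_toNNReal _ (by positivity), ENNReal.ofReal_rpow_of_nonneg (abs_nonneg _)
        (by positivity), ← ENNReal.ofReal_coe_nnreal, Real.coe_toNNReal _ (by positivity),
      ← ENNReal.ofReal_mul (by positivity)]
    exact ENNReal.ofReal_le_ofReal h7
  have hdim := hholder.dimH_image_le (Real.toNNReal_pos.2 (inv_pos.2 hkR))
  have himage : Set.Icc (0 : ℝ) 1 ⊆ f '' Set.range x := by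
    intro y hy
    obtain ⟨b, -, rfl⟩ := Real.ofDigits_SurjOn one_lt_two hy
    exact ⟨x b, ⟨b, rfl⟩, hf b⟩
  have hone : dimH (Set.Icc (0 : ℝ) 1) = 1 := by
    rw [Real.dimH_of_mem_nhds (x := (1 / 2 : ℝ)) (Icc_mem_nhds (by norm_num) (by norm_num))]
    simp
  have hrange : 0 < dimH (Set.range x) := by
    rw [pos_iff_ne_zero]
    intro h0
    have h1 := (hone.symm.le.trans (dimH_mono himage)).trans hdim
    rw [h0, ENNReal.zero_div] at h1
    exact absurd h1 (by simp)
  exact hrange.trans_le (dimH_mono (Set.range_subset_iff.2 hxK))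

/-- `LittleCovered` passes to two separated children, so it can label the nodes of the binary tree;
what remains is that limit points lie in no interval of any `Γ a`. -/
theorem dimH_pos_of_littleCovered {ι : Type*} {Γ : ι → Set (ℝ × ℝ)} {A : Finset ι} {τ ℓ u : ℝ}
    {k : ℕ} (hΓ : ∀ a ∈ A, IntervalsSeparated τ (Γ a)) (hτ : 0 < τ) (hℓ : 0 < ℓ) (hk : 6 ≤ 2 ^ k)
    (hcard : 16 * A.card ≤ 2 ^ k)
    (hsum : (A.card : ℝ) * (1 + (harmonic (2 ^ k) : ℝ)) ≤ τ / 64)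
    (h : LittleCovered Γ A τ ℓ u) :
    0 < dimH {x | x ∈ Set.Icc u (u + ℓ) ∧ ∀ a ∈ A, ∀ g ∈ Γ a, x ∉ Set.Ioo g.1 g.2} := by
  have hk0 : 0 < k := by
    rcases Nat.eq_zero_or_pos k with rfl | h
    · norm_num at hk
    · exact h
  have hk1 : (1 : ℝ) < 2 ^ k := one_lt_pow₀ one_lt_two hk0.ne'
  refine (dimH_pos_of_binary_tree hk0 hℓ (fun d v => LittleCovered Γ A τ d v) h ?_).trans_le
    (dimH_mono ?_)
  · intro d v hd hP
    obtain ⟨i, j, hij, hjT, hi, hj⟩ := hP.exists_children hΓ hτ hd hk hcard hsum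
    push_cast at hi hj
    have hd' : 0 < d / 2 ^ k := by positivity
    refine ⟨_, _, ?_, ?_, ?_, hi, hj⟩
    · have : 0 ≤ (i : ℝ) * (d / 2 ^ k) := by positivity
      linarith
    · have : ((i : ℝ) + 2) * (d / 2 ^ k) ≤ j * (d / 2 ^ k) := by
        gcongr
        exact_mod_cast hij
      linarith
    · have h1 : ((j : ℝ) + 1) * (d / 2 ^ k) ≤ 2 ^ k * (d / 2 ^ k) := by
        gcongr
        exact_mod_cast hjT
      rw [mul_div_cancel₀ _ (by positivity)] at h1
      linarith
  · rintro x ⟨s, hs0, hs⟩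
    refine ⟨by simpa [hs0] using (hs 0).2, fun a ha g hg hx => ?_⟩
    have hlim : Filter.Tendsto (fun n : ℕ => ℓ / ((2 : ℝ) ^ k) ^ n) Filter.atTop (nhds 0) :=
      Filter.Tendsto.const_div_atTop (tendsto_pow_atTop_atTop_of_one_lt hk1) ℓ
    have hlim' : Filter.Tendsto (fun n : ℕ => ℓ / ((2 : ℝ) ^ k) ^ n / τ) Filter.atTop (nhds 0) := by
      simpa using hlim.div_const τ
    obtain ⟨n, h1, h2, h3⟩ := ((hlim.eventually_lt_const (sub_pos.2 hx.1)).and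
      ((hlim.eventually_lt_const (sub_pos.2 hx.2)).and
        (hlim'.eventually_lt_const (sub_pos.2 (hx.1.trans hx.2))))).exists
    obtain ⟨hP, hxn⟩ := hs n
    set d := ℓ / ((2 : ℝ) ^ k) ^ n with hd
    have hd0 : 0 < d := by positivity
    -- At this depth the tree interval around `x` lies inside `g`, and `g` is long enough to be
    -- counted: it covers everything instead of at most a quarter.
    have hsub : Set.Ico (s n) (s n + d) ⊆ longUnion (Γ a) (d / τ) := fun y hy =>
      mem_longUnion.2 ⟨g, hg, h3, by linarith [hy.1, hxn.2], by linarith [hy.2, hxn.1]⟩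
    have hle : volume.real (Set.Ico (s n) (s n + d) ∩ longUnion (Γ a) (d / τ)) ≤ d / 4 :=
      (Finset.single_le_sum (f := fun a => volume.real (Set.Ico (s n) (s n + d) ∩
        longUnion (Γ a) (d / τ))) (fun _ _ => measureReal_nonneg) ha).trans hP
    rw [Set.inter_eq_left.2 hsub, Real.volume_real_Ico_of_le (by linarith)] at hle
    linarith

/-! ### From thickness to separated gaps -/

theorem subset_of_mem_connectedComponentIn {S : Set ℝ} {x y : ℝ}
    (hy : y ∈ connectedComponentIn S x) : Set.uIcc x y ⊆ S := by
  -- `connectedComponentIn S x` is empty by convention when `x ∉ S`.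
  have hx : x ∈ S := by
    by_contra hx
    rw [connectedComponentIn_eq_empty hx] at hy
    exact hy
  exact (isPreconnected_connectedComponentIn.ordConnected.uIcc_subset
    (mem_connectedComponentIn hx) hy).trans (connectedComponentIn_subset S x)

theorem le_or_le_of_mem_gaps {C : Set ℝ} {g h : ℝ × ℝ} (hg : g ∈ gaps C) (hh : h ∈ gaps C)
    (hne : g ≠ h) : g.2 ≤ h.1 ∨ h.2 ≤ g.1 := by
  obtain ⟨g1, g2, g3, g4⟩ := hg
  obtain ⟨h1, h2, h3, h4⟩ := hh
  rw [Set.disjoint_right] at g4 h4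
  by_contra! hcon
  have e1 : ¬ g.1 < h.1 := fun hlt => g4 h2 ⟨hlt, hcon.1⟩
  have e2 : ¬ h.1 < g.1 := fun hlt => h4 g2 ⟨hlt, hcon.2⟩
  have e3 : ¬ g.2 < h.2 := fun hlt => h4 g3 ⟨hcon.1, hlt⟩
  have e4 : ¬ h.2 < g.2 := fun hlt => g4 h3 ⟨hcon.2, hlt⟩
  exact hne (Prod.ext (by linarith) (by linarith))

theorem disjoint_stage {C : Set ℝ} {g h : ℝ × ℝ} (hh : h ∈ gaps C)
    (hgh : h = g ∨ RemovedBefore h g) : Disjoint (Set.Ioo h.1 h.2) (stage C g) :=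
  Set.disjoint_left.2 fun _ hx hx' => hx'.2 (Set.mem_biUnion (x := h) ⟨hh, hgh⟩ hx)

/-- A connected piece that left this range would contain points of `h` or of `g`, both already
removed at this stage. -/
theorem leftPiece_subset_Icc {C : Set ℝ} {g h : ℝ × ℝ} (hg : g ∈ gaps C) (hh : h ∈ gaps C)
    (hhg : RemovedBefore h g) (hle : h.2 ≤ g.1) : leftPiece C g ⊆ Set.Icc h.2 g.1 := by
  intro y hy
  have hsub := subset_of_mem_connectedComponentIn hy
  have hdg := Set.disjoint_left.1 (disjoint_stage (g := g) hg (Or.inl rfl))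
  have hdh := Set.disjoint_left.1 (disjoint_stage hh (Or.inr hhg))
  have hg1 := hg.1
  have hh1 := hh.1
  constructor
  · by_contra! hlt
    obtain ⟨z, hz1, hz2⟩ := exists_between (max_lt hlt hh1)
    rw [max_lt_iff] at hz1
    exact hdh ⟨hz1.2, hz2⟩ (hsub (Set.mem_uIcc.2 (Or.inr ⟨hz1.1.le, hz2.le.trans hle⟩)))
  · by_contra! hlt
    obtain ⟨z, hz1, hz2⟩ := exists_between (lt_min hlt hg1)
    rw [lt_min_iff] at hz2
    exact hdg ⟨hz1, hz2.2⟩ (hsub (Set.mem_uIcc.2 (Or.inl ⟨hz1.le, hz2.1.le⟩)))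

theorem rightPiece_subset_Icc {C : Set ℝ} {g h : ℝ × ℝ} (hg : g ∈ gaps C) (hh : h ∈ gaps C)
    (hhg : RemovedBefore h g) (hle : g.2 ≤ h.1) : rightPiece C g ⊆ Set.Icc g.2 h.1 := by
  intro y hy
  have hsub := subset_of_mem_connectedComponentIn hy
  have hdg := Set.disjoint_left.1 (disjoint_stage (g := g) hg (Or.inl rfl))
  have hdh := Set.disjoint_left.1 (disjoint_stage hh (Or.inr hhg))
  have hg1 := hg.1
  have hh1 := hh.1
  constructor
  · by_contra! hlt
    obtain ⟨z, hz1, hz2⟩ := exists_between (max_lt hlt hg1)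
    rw [max_lt_iff] at hz1
    exact hdg ⟨hz1.2, hz2⟩ (hsub (Set.mem_uIcc.2 (Or.inr ⟨hz1.1.le, hz2.le⟩)))
  · by_contra! hlt
    obtain ⟨z, hz1, hz2⟩ := exists_between (lt_min hlt hh1)
    rw [lt_min_iff] at hz2
    exact hdh ⟨hz1, hz2.2⟩ (hsub (Set.mem_uIcc.2 (Or.inl ⟨hle.trans hz1.le, hz2.1.le⟩)))

theorem leftPiece_subset_Icc_csInf {C : Set ℝ} (hC : IsCompact C) (g : ℝ × ℝ) :
    leftPiece C g ⊆ Set.Icc (sInf C) (sSup C) :=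
  (connectedComponentIn_subset _ _).trans <| Set.sdiff_subset.trans <|
    convexHull_min (fun _ hx => ⟨csInf_le hC.bddBelow hx, le_csSup hC.bddAbove hx⟩)
      (convex_Icc _ _)

theorem ofReal_mul_length_le_volume {C : Set ℝ} {τ : ℝ} (hsub : ¬ C.Subsingleton) (hτ0 : 0 ≤ τ)
    (hτ : ENNReal.ofReal τ ≤ thickness C) {g : ℝ × ℝ} (hg : g ∈ gaps C) :
    ENNReal.ofReal (τ * (g.2 - g.1)) ≤ volume (leftPiece C g) ∧
      ENNReal.ofReal (τ * (g.2 - g.1)) ≤ volume (rightPiece C g) := by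
  rw [thickness, if_neg hsub] at hτ
  have h := hτ.trans (iInf₂_le g hg)
  have hpos : ENNReal.ofReal (g.2 - g.1) ≠ 0 := (ENNReal.ofReal_pos.2 (sub_pos.2 hg.1)).ne'
  rw [ENNReal.le_div_iff_mul_le (Or.inl hpos) (Or.inl ENNReal.ofReal_ne_top),
    ← ENNReal.ofReal_mul hτ0] at h
  exact le_min_iff.1 h

theorem mul_length_le_of_subset_Icc {s : Set ℝ} {a b c : ℝ} (hc : 0 < c)
    (h : ENNReal.ofReal c ≤ volume s) (hs : s ⊆ Set.Icc a b) : c ≤ b - a := by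
  have := h.trans (measure_mono hs)
  rw [Real.volume_Icc, ENNReal.ofReal_le_ofReal_iff'] at this
  exact this.resolve_right (not_le.2 hc)

theorem mul_length_le_diam {C : Set ℝ} (hC : IsCompact C) {τ : ℝ} (hsub : ¬ C.Subsingleton)
    (hτ0 : 0 < τ) (hτ : ENNReal.ofReal τ ≤ thickness C) {g : ℝ × ℝ} (hg : g ∈ gaps C) :
    τ * (g.2 - g.1) ≤ Metric.diam C := by
  rw [Real.diam_eq hC.isBounded]
  exact mul_length_le_of_subset_Icc (mul_pos hτ0 (sub_pos.2 hg.1))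
    (ofReal_mul_length_le_volume hsub hτ0.le hτ hg).1 (leftPiece_subset_Icc_csInf hC g)

/-- Of two gaps, consider the one removed later, which is no longer than the other. Its piece on the
side of the other gap fits between the two, and thickness makes that piece at least `τ` times as
long as the gap. -/
theorem intervalsSeparated_gaps {C : Set ℝ} {τ : ℝ} (hsub : ¬ C.Subsingleton) (hτ0 : 0 < τ)
    (hτ : ENNReal.ofReal τ ≤ thickness C) : IntervalsSeparated τ (gaps C) := by
  have key : ∀ g ∈ gaps C, ∀ h ∈ gaps C, g.2 ≤ h.1 →
      τ * min (g.2 - g.1) (h.2 - h.1) ≤ h.1 - g.2 := by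
    intro g hg h hh hle
    rcases le_or_gt (h.2 - h.1) (g.2 - g.1) with hlen | hlen
    · rw [min_eq_right hlen]
      have hbefore : RemovedBefore g h := by
        rcases hlen.lt_or_eq with hlt | heq
        · exact Or.inl hlt
        -- Equal lengths: the left gap goes first, so the left piece of `h` is the one to use.
        · exact Or.inr ⟨heq.symm, hg.1.trans_le hle⟩
      exact mul_length_le_of_subset_Icc (mul_pos hτ0 (sub_pos.2 hh.1))
        (ofReal_mul_length_le_volume hsub hτ0.le hτ hh).1 (leftPiece_subset_Icc hh hg hbefore hle)
    · rw [min_eq_left hlen.le]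
      exact mul_length_le_of_subset_Icc (mul_pos hτ0 (sub_pos.2 hg.1))
        (ofReal_mul_length_le_volume hsub hτ0.le hτ hg).2
        (rightPiece_subset_Icc hg hh (Or.inl hlen) hle)
  intro g hg h hh hne x hx y hy
  rcases le_or_le_of_mem_gaps hg hh hne with hle | hle
  · have := key g hg h hh hle
    rw [abs_sub_comm]
    exact this.trans ((by linarith [hx.2, hy.1] : h.1 - g.2 ≤ y - x).trans (le_abs_self _))
  · have := key h hh g hg hle
    rw [min_comm]
    exact this.trans ((by linarith [hx.1, hy.2] : g.1 - h.2 ≤ x - y).trans (le_abs_self _))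

/-- A point of the hull outside `C` lies in the gap between the last point of `C` before it and the
first one after it. -/
theorem mem_of_forall_gaps_notMem {C : Set ℝ} (hC : IsCompact C) (hne : C.Nonempty) {y : ℝ}
    (hy : y ∈ Set.Icc (sInf C) (sSup C)) (hgap : ∀ g ∈ gaps C, y ∉ Set.Ioo g.1 g.2) : y ∈ C := by
  by_contra hyC
  have hL := (hC.inter_right isClosed_Iic).sSup_mem (s := C ∩ Set.Iic y)
    ⟨sInf C, hC.sInf_mem hne, hy.1⟩
  have hR := (hC.inter_right isClosed_Ici).sInf_mem (s := C ∩ Set.Ici y)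
    ⟨sSup C, hC.sSup_mem hne, hy.2⟩
  have hLy : sSup (C ∩ Set.Iic y) < y := hL.2.lt_of_ne fun h => hyC (h ▸ hL.1)
  have hRy : y < sInf (C ∩ Set.Ici y) := lt_of_le_of_ne hR.2 fun h => hyC (h ▸ hR.1)
  refine hgap (sSup (C ∩ Set.Iic y), sInf (C ∩ Set.Ici y))
    ⟨hLy.trans hRy, hL.1, hR.1, Set.disjoint_left.2 fun z hz hzC => ?_⟩ ⟨hLy, hRy⟩
  rcases le_total z y with h | h
  · exact not_le.2 hz.1 (le_csSup (hC.bddAbove.mono Set.inter_subset_left) ⟨hzC, h⟩)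
  · exact not_le.2 hz.2 (csInf_le (hC.bddBelow.mono Set.inter_subset_left) ⟨hzC, h⟩)

/-! ### Translated gaps, choice of parameters and conclusion -/

/-- The family of intervals of `Γ` translated by `-a`. -/
def translateIntervals (Γ : Set (ℝ × ℝ)) (a : ℝ) : Set (ℝ × ℝ) := {g | (g.1 + a, g.2 + a) ∈ Γ}

theorem IntervalsSeparated.translate {τ : ℝ} {Γ : Set (ℝ × ℝ)} (hΓ : IntervalsSeparated τ Γ)
    (a : ℝ) : IntervalsSeparated τ (translateIntervals Γ a) := by
  intro g hg h hh hne x hx y hy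
  have := hΓ _ hg _ hh (fun e => hne (by
    rw [Prod.mk.injEq] at e
    exact Prod.ext (by linarith [e.1]) (by linarith [e.2])))
    (x + a) ⟨by linarith [hx.1], by linarith [hx.2]⟩ (y + a) ⟨by linarith [hy.1], by linarith [hy.2]⟩
  simpa using this

/-- At most one interval longer than `ℓ / τ` meets the window; this starts the tree at its root. -/
theorem IntervalsSeparated.volume_long_le {τ u ℓ m : ℝ} {Γ : Set (ℝ × ℝ)}
    (hΓ : IntervalsSeparated τ Γ) (hτ : 0 < τ) (hm : 0 ≤ m) (hshort : ∀ g ∈ Γ, g.2 - g.1 ≤ m) :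
    volume.real (Set.Ico u (u + ℓ) ∩ longUnion Γ (ℓ / τ)) ≤ m := by
  rcases (Set.Ico u (u + ℓ) ∩ longUnion Γ (ℓ / τ)).eq_empty_or_nonempty with h | ⟨x, hx, hx'⟩
  · rw [h]; simpa using hm
  obtain ⟨g, hg, hlen, hxg⟩ := mem_longUnion.1 hx'
  have hsub : Set.Ico u (u + ℓ) ∩ longUnion Γ (ℓ / τ) ⊆ Set.Ioo g.1 g.2 := by
    rintro y ⟨hy, hy'⟩
    obtain ⟨h, hh, hlen', hyh⟩ := mem_longUnion.1 hy'
    rw [hΓ.eq_of_long hτ hg hh hlen hlen' hx hy hxg hyh]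
    exact hyh
  refine (measureReal_mono hsub measure_Ioo_lt_top.ne).trans ?_
  rw [Real.volume_real_Ioo_of_le (hxg.1.trans hxg.2).le]
  exact hshort g hg

theorem exists_two_pow_of_mul_log_le {τ : ℝ} {N : ℕ} (hτ : Real.exp 1 ≤ τ) (hN : 0 < N)
    (h : (N : ℝ) * Real.log τ ≤ τ / 256) :
    (N : ℝ) ≤ τ / 256 ∧ ∃ k : ℕ, 6 ≤ 2 ^ k ∧ 16 * N ≤ 2 ^ k ∧
      (N : ℝ) * (1 + (harmonic (2 ^ k) : ℝ)) ≤ τ / 64 := by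
  have hτ0 : 0 < τ := (Real.exp_pos 1).trans_le hτ
  have hlog : 1 ≤ Real.log τ := (Real.le_log_iff_exp_le hτ0).2 hτ
  have hN1 : (1 : ℝ) ≤ N := by exact_mod_cast hN
  have hNτ : (N : ℝ) ≤ τ / 256 := by nlinarith
  refine ⟨hNτ, ?_⟩
  -- The number of children is the power of 2 in `(τ, 2 τ]`, so its harmonic sum is at most `1 + log
  -- (2 τ)`.
  obtain ⟨n, hn, hn'⟩ := exists_nat_pow_near (x := τ) (y := 2) (by linarith) one_lt_two
  have h2 : ((2 : ℝ)) ^ (n + 1) ≤ 2 * τ := by rw [pow_succ]; linarith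
  refine ⟨n + 1, ?_, ?_, ?_⟩
  · have : (6 : ℝ) ≤ 2 ^ (n + 1) := by linarith
    exact_mod_cast this
  · have : (16 : ℝ) * N ≤ 2 ^ (n + 1) := by linarith
    exact_mod_cast this
  · have h3 := harmonic_le_one_add_log (2 ^ (n + 1))
    push_cast at h3
    have h4 := Real.log_le_log (by positivity) h2
    rw [Real.log_mul two_ne_zero hτ0.ne'] at h4
    have h5 := Real.log_two_lt_d9
    have h6 : 1 + (harmonic (2 ^ (n + 1)) : ℝ) ≤ 4 * Real.log τ := by linarith
    calc (N : ℝ) * (1 + (harmonic (2 ^ (n + 1)) : ℝ)) ≤ N * (4 * Real.log τ) := by gcongr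
      _ ≤ τ / 64 := by linarith

/-- Only a real lower bound for the thickness is needed. For infinite thickness any large `τ` will
do, as `log τ = o(τ)`; otherwise `τ` is the thickness itself, and the constant in `patternBound` is
far below `1 / 256`. -/
theorem exists_real_le_thickness {C : Set ℝ} {N : ℕ}
    (hτ : ENNReal.ofReal (Real.exp 1) ≤ thickness C) (hN : (N : ℕ∞) ≤ patternBound (thickness C)) :
    ∃ τ : ℝ, Real.exp 1 ≤ τ ∧ ENNReal.ofReal τ ≤ thickness C ∧
      (N : ℝ) * Real.log τ ≤ τ / 256 := by
  by_cases htop : thickness C = ⊤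
  · have h := Real.isLittleO_log_id_atTop.def (c := 1 / (256 * (N + 1))) (by positivity)
    obtain ⟨τ, h1, h2⟩ := (h.and (Filter.eventually_ge_atTop (Real.exp 1))).exists
    refine ⟨τ, h2, by rw [htop]; exact le_top, ?_⟩
    have hτ0 : 0 < τ := (Real.exp_pos 1).trans_le h2
    have hlog : 1 ≤ Real.log τ := (Real.le_log_iff_exp_le hτ0).2 h2
    simp only [id, Real.norm_eq_abs, abs_of_pos hτ0] at h1
    rw [abs_of_nonneg (by linarith)] at h1
    calc (N : ℝ) * Real.log τ ≤ (N + 1) * (1 / (256 * (N + 1)) * τ) := by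
          gcongr
          linarith
      _ = τ / 256 := by field_simp
  · rw [patternBound, if_neg htop, Nat.cast_le] at hN
    set τ := (thickness C).toReal with hτdef
    have hτe : Real.exp 1 ≤ τ := (ENNReal.ofReal_le_iff_le_toReal htop).1 hτ
    have hτ0 : 0 < τ := (Real.exp_pos 1).trans_le hτe
    have hlog : 1 ≤ Real.log τ := (Real.le_log_iff_exp_le hτ0).2 hτe
    refine ⟨τ, hτe, (ENNReal.ofReal_toReal htop).le, ?_⟩
    have hlog4 : Real.log 4 ≤ 3 := by
      have := Real.log_le_sub_one_of_pos (x := 4) (by norm_num)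
      linarith
    have hlog4' : 0 ≤ Real.log 4 := Real.log_nonneg (by norm_num)
    have hexp : 1 ≤ Real.exp 1 := Real.one_le_exp zero_le_one
    have hc : Real.log 4 / (4 * Real.exp 1 * 720 ^ 2) ≤ 1 / 256 := by
      rw [div_le_div_iff₀ (by positivity) (by norm_num)]
      nlinarith
    have hle : (N : ℝ) ≤ Real.log 4 / (4 * Real.exp 1 * 720 ^ 2) * (τ / Real.log τ) :=
      (Nat.cast_le.2 hN).trans (Nat.floor_le (by positivity))
    calc (N : ℝ) * Real.log τ ≤ 1 / 256 * (τ / Real.log τ) * Real.log τ := by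
          gcongr
          exact hle.trans (by gcongr)
      _ = τ / 256 := by field_simp

theorem dimH_copySet_one_pos {C : Set ℝ} (hC : IsCompact C)
    (hτ : ENNReal.ofReal (Real.exp 1) ≤ thickness C)
    {A : Finset ℝ} (hA : (A.card : ℕ∞) ≤ patternBound (thickness C))
    (hdiam : Metric.diam (A : Set ℝ) < Metric.diam C / 8) : 0 < dimH (copySet C A 1) := by
  rcases A.eq_empty_or_nonempty with rfl | hAne
  · have : copySet C ∅ 1 = Set.univ := by simp [copySet]
    rw [this, Real.dimH_univ]
    exact one_pos
  have hD : 0 < Metric.diam C := by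
    have := Metric.diam_nonneg (s := (A : Set ℝ))
    linarith
  have hsub : ¬ C.Subsingleton := fun h => hD.ne' (Metric.diam_subsingleton h)
  have hCne : C.Nonempty := (Set.not_subsingleton_iff.1 hsub).nonempty
  obtain ⟨τ, hτe, hτC, hNlog⟩ := exists_real_le_thickness hτ hA
  have hτ0 : 0 < τ := (Real.exp_pos 1).trans_le hτe
  obtain ⟨hN, k, hk, hk16, hsum⟩ := exists_two_pow_of_mul_log_le hτe hAne.card_pos hNlog
  have hsep := intervalsSeparated_gaps hsub hτ0 hτC
  have hAbdd : Bornology.IsBounded (A : Set ℝ) := A.finite_toSet.isBounded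
  have hAdiam := Real.diam_eq hAbdd
  have hCdiam := Real.diam_eq hC.isBounded
  -- For `x ∈ [u, u + ℓ]` every `a + x` with `a ∈ A` lies in the hull of `C`.
  set u := sInf C - sInf (A : Set ℝ) with hu
  set ℓ := Metric.diam C - Metric.diam (A : Set ℝ) with hℓ
  have hℓ0 : Metric.diam C / 4 ≤ ℓ := by linarith
  -- Each gap has length at most `diam C / τ` and `|A| ≤ τ / 256`, so the root is covered up to at
  -- most `diam C / 256`.
  have hcov : LittleCovered (translateIntervals (gaps C)) A τ ℓ u := by
    calc _ ≤ ∑ a ∈ A, Metric.diam C / τ := Finset.sum_le_sum fun a _ => by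
          refine (hsep.translate a).volume_long_le hτ0 (by positivity) fun g hg => ?_
          have := mul_length_le_diam hC hsub hτ0 hτC hg
          rw [le_div_iff₀ hτ0]
          simp only at this
          linarith
      _ = A.card * (Metric.diam C / τ) := by simp
      _ ≤ τ / 256 * (Metric.diam C / τ) := by gcongr
      _ = Metric.diam C / 256 := by field_simp
      _ ≤ ℓ / 4 := by linarith
  refine (dimH_pos_of_littleCovered (fun a _ => hsep.translate a) hτ0 (by linarith) hk hk16 hsum
    hcov).trans_le (dimH_mono ?_)
  rintro x ⟨hx, hxgap⟩ a ha
  have ha1 : sInf (A : Set ℝ) ≤ a := csInf_le hAbdd.bddBelow ha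
  have ha2 : a ≤ sSup (A : Set ℝ) := le_csSup hAbdd.bddAbove ha
  refine mem_of_forall_gaps_notMem hC hCne ⟨by linarith [hx.1], by linarith [hx.2]⟩
    fun g hg hxg => ?_
  refine hxgap a ha (g.1 - a, g.2 - a) ?_ ⟨by linarith [hxg.1], by linarith [hxg.2]⟩
  simpa [translateIntervals] using hg

theorem mainTheorem1 (C : Set ℝ) (hC : IsCompact C)
    (hτ : ENNReal.ofReal (Real.exp 1) ≤ thickness C)
    (A : Finset ℝ) (hA : (A.card : ℕ∞) ≤ patternBound (thickness C)) :
    (∃ r : ℝ, 0 < r ∧ ∃ x : ℝ, ∀ a ∈ A, r * a + x ∈ C) ∧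
    (∃ r : ℝ, 0 < r ∧ 0 < dimH (copySet C A r)) ∧
    (Metric.diam (A : Set ℝ) < Metric.diam C / 8 → 0 < dimH (copySet C A 1)) := by
  classical
  have hscaled : ∃ r : ℝ, 0 < r ∧ 0 < dimH (copySet C A r) := by
    have hsub : ¬ C.Subsingleton := fun h => by
      rw [thickness, if_pos h] at hτ
      exact not_lt.2 hτ (ENNReal.ofReal_pos.2 (Real.exp_pos 1))
    have hD : 0 < Metric.diam C := Metric.diam_pos (Set.not_subsingleton_iff.1 hsub) hC.isBounded
    have hA0 := Metric.diam_nonneg (s := (A : Set ℝ))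
    -- This makes the diameter of `r A` at most `diam C / 16`; the `+ 1` handles `diam A = 0`.
    set r := Metric.diam C / (16 * (Metric.diam (A : Set ℝ) + 1)) with hr
    have hr0 : 0 < r := by positivity
    refine ⟨r, hr0, ?_⟩
    have hcopy : copySet C (A.image fun a => r * a) 1 = copySet C A r := by
      simp [copySet]
    rw [← hcopy]
    refine dimH_copySet_one_pos hC hτ ((Nat.cast_le.2 Finset.card_image_le).trans hA) ?_
    have hle : Metric.diam ((A.image fun a => r * a : Finset ℝ) : Set ℝ) ≤
        r * Metric.diam (A : Set ℝ) := by
      refine Metric.diam_le_of_forall_dist_le (by positivity) fun x hx y hy => ?_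
      simp only [Finset.coe_image, Set.mem_image] at hx hy
      obtain ⟨a, ha, rfl⟩ := hx
      obtain ⟨b, hb, rfl⟩ := hy
      rw [Real.dist_eq, ← mul_sub, abs_mul, abs_of_pos hr0]
      gcongr
      exact Metric.dist_le_diam_of_mem A.finite_toSet.isBounded ha hb
    have hlt : r * Metric.diam (A : Set ℝ) ≤ r * (Metric.diam (A : Set ℝ) + 1) := by
      gcongr
      linarith
    have heq : r * (Metric.diam (A : Set ℝ) + 1) = Metric.diam C / 16 := by
      rw [hr]; field_simp
    linarith
  refine ⟨?_, hscaled, dimH_copySet_one_pos hC hτ hA⟩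
  obtain ⟨r, hr, hdim⟩ := hscaled
  refine ⟨r, hr, ?_⟩
  rcases (copySet C A r).eq_empty_or_nonempty with h | ⟨x, hx⟩
  · rw [h, dimH_empty] at hdim
    exact absurd hdim (lt_irrefl _)
  · exact ⟨x, hx⟩
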